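/- Let $(M,\mathrm{dist})$ be a non-trivial Peano space, i.e. a compact, connected, locally connected metric space with more than one point. Let $F\subset M\times M$ be a relation, write $F(x)=\{y:(x,y)\in F\}$, $F^{-1}=\{(y,x):(x,y)\in F\}$, let $F^0$ be the identity relation, $F^{n+1}=F\circ F^n$ and $F^{-n}=(F^{-1})^n$ for $n\ge 0$. Let $d_H$ be the Hausdorff distance. Assume that - $F(x)\neq\emptyset$ for every $x\in M$, and $F(M)=M$; - $F(x)$ is closed for every $x\in M$, and $x\mapsto F(x)$ is continuous with respect to $d_H$; - $F$ is positively expansive: there is $\alpha>0$ such that for all $x\ne y$ in $M$ there is an integer $n\ge 0$ with $d_H(F^n(x),F^n(y))>\alpha$; - (1) $F(x)$ is a continuum (compact and connected) for every $x\in M$, or (2) the family $\mathcal D(M)=\{F^n(x): x\in M,\ n\in\mathbb Z\}$ is closed in the space of non-empty closed subsets of $M$ with the metric $d_H$. The suborbits of $F$ are the sequences $(x_i)_{i\in\mathbb Z}$ with $(x_i,x_{i+1})\in F$ for all $i$. A set $A$ of segments $(x_0,\dots,x_{n-1})$ of suborbits is $(n,\epsilon)$-separated if any two distinct elements $(x_i),(y_i)$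 of $A$ satisfy $\mathrm{dist}(x_i,y_i)>\epsilon$ for at least one $i$. Let $s_n(\epsilon)$ be the greatest cardinality of an $(n,\epsilon)$-separated set, and $$h_{top}(F)=\lim_{\epsilon\to0^+}\limsup_{n\to\infty}\tfrac1n\log s_n(\epsilon)\in[0,\infty].$$ Let $M^F=\{(x_i)_{i\ge0}: (x_i,x_{i+1})\in F \text{ for all } i\ge 0\}$ be the space of forward suborbits, with the metric $\rho(x,y)=\sum_{j\ge0}2^{-j}\,\mathrm{dist}(x_j,y_j)$, let $\sigma_F:M^F\to M^F$, $\sigma_F(x)_i=x_{i+1}$, be the one-sided shift, and let $h_{top}(\sigma_F)\in[0,\infty]$ be its topological entropy. Then $$h_{top}(\sigma_F)\ \ge\ h_{top}(F)\ >\ 0 .$$ -/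

import Mathlib

open Filter Topology Set

noncomputable section

namespace SetValued

variable {M : Type*}

/-- The image `F(x) = {y : (x, y) ∈ F}` of a point under a relation `F ⊆ M × M`. -/
def im (F : SetRel M M) (x : M) : Set M := {y | (x, y) ∈ F}

/-- Non-negative iterates of a relation: `F⁰` is the identity and `Fⁿ⁺¹ = F ∘ Fⁿ` (first `Fⁿ`,
then `F`; Mathlib's `SetRel.comp` takes its arguments in diagrammatic order). -/
def iter (F : SetRel M M) : ℕ → SetRel M M
  | 0 => SetRel.id
  | n + 1 => (iter F n).comp F

/-- Integer iterates of a relation: `F⁻ⁿ = (F⁻¹)ⁿ`. -/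
def ziter (F : SetRel M M) : ℤ → SetRel M M
  | Int.ofNat n => iter F n
  | Int.negSucc n => iter F.inv (n + 1)

/-- Both `F` and `F⁻¹` are set valued maps: `F(x) ≠ ∅` for every `x`, and `F(M) = M`. -/
def IsSurjective (F : SetRel M M) : Prop :=
  (∀ x, ∃ y, (x, y) ∈ F) ∧ (∀ y, ∃ x, (x, y) ∈ F)

/-- Continuity of `x ↦ F(x)` for the Hausdorff distance. -/
def HausdorffContinuous [MetricSpace M] (F : SetRel M M) : Prop :=
  ∀ x : M, ∀ ε > 0, ∃ δ > 0, ∀ y : M, dist x y < δ → Metric.hausdorffDist (im F x) (im F y) < ε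

/-- The separation condition of positive expansiveness: there is `α > 0` such that any two
distinct points `x, y` satisfy `d_H(Fⁿ(x), Fⁿ(y)) > α` for some `n ≥ 0`. -/
def PositivelyExpansive [MetricSpace M] (F : SetRel M M) : Prop :=
  ∃ α > 0, ∀ x y : M, x ≠ y →
    ∃ n : ℕ, α < Metric.hausdorffDist (im (iter F n) x) (im (iter F n) y)

/-- The family `𝒟(M)` of all sets `Fⁿ(x)`, `x ∈ M`, `n ∈ ℤ`, inside the hyperspace of non-empty
compact subsets of `M` (whose topology is that of the Hausdorff metric). -/
def iterateFamily [MetricSpace M] (F : SetRel M M) : Set (TopologicalSpace.NonemptyCompacts M) :=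
  {K | ∃ (x : M) (n : ℤ), im (ziter F n) x = (K : Set M)}

/-- The (two-sided) suborbits of `F`. -/
def suborbits (F : SetRel M M) : Set (ℤ → M) :=
  {x | ∀ i : ℤ, (x i, x (i + 1)) ∈ F}

/-- The segments `(x₀, …, xₙ₋₁)` of suborbits of `F`. -/
def segments (F : SetRel M M) (n : ℕ) : Set (Fin n → M) :=
  {s | ∃ x ∈ suborbits F, ∀ i : Fin n, s i = x (i : ℕ)}

/-- `A` is an `(n, ε)`-separated set of segments of suborbits. -/
def IsSeparated [MetricSpace M] (F : SetRel M M) (n : ℕ) (ε : ℝ) (A : Set (Fin n → M)) : Prop :=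
  A ⊆ segments F n ∧ ∀ s ∈ A, ∀ t ∈ A, s ≠ t → ∃ i, ε < dist (s i) (t i)

/-- `sₙ(ε)`, the greatest cardinality of an `(n, ε)`-separated set. -/
def sepNumber [MetricSpace M] (F : SetRel M M) (n : ℕ) (ε : ℝ) : ℕ∞ :=
  ⨆ (A : Finset (Fin n → M)) (_ : IsSeparated F n ε (A : Set (Fin n → M))), (A.card : ℕ∞)

/-- `limsup (1/n) log sₙ(ε)` as `n → ∞`. -/
def entropyAt [MetricSpace M] (F : SetRel M M) (ε : ℝ) : EReal :=
  limsup (fun n : ℕ => ENNReal.log (sepNumber F n ε : ENNReal) / (n : EReal)) atTop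

/-- The topological entropy of `F`: the limit of `limsup (1/n) log sₙ(ε)` as `ε → 0`, which is the
supremum over `ε > 0` (see `tendsto_entropyAt`). -/
def entropy [MetricSpace M] (F : SetRel M M) : EReal :=
  ⨆ (ε : ℝ) (_ : 0 < ε), entropyAt F ε

theorem entropyAt_antitone [MetricSpace M] (F : SetRel M M) : Antitone (entropyAt F) := by
  intro ε ε' h
  refine limsup_le_limsup (Eventually.of_forall fun n => ?_)
  refine EReal.div_le_div_right_of_nonneg (by exact_mod_cast Nat.zero_le n) ?_
  refine ENNReal.log_monotone (ENat.toENNReal_mono ?_)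
  refine iSup₂_le fun A hA => le_iSup₂_of_le A ⟨hA.1, fun s hs t ht hst => ?_⟩ le_rfl
  obtain ⟨i, hi⟩ := hA.2 s hs t ht hst
  exact ⟨i, h.trans_lt hi⟩

theorem tendsto_entropyAt [MetricSpace M] (F : SetRel M M) :
    Tendsto (entropyAt F) (𝓝[>] 0) (𝓝 (entropy F)) := by
  have h := (entropyAt_antitone F).tendsto_nhdsGT 0
  rwa [sSup_image] at h

/-- The space `M^F` of forward suborbits: sequences `(xₙ)` with `(xₙ, xₙ₊₁) ∈ F` for all `n ≥ 0`. -/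
def ForwardSuborbits (F : SetRel M M) : Type _ :=
  {x : ℕ → M // ∀ i : ℕ, (x i, x (i + 1)) ∈ F}

theorem summable_rho [MetricSpace M] [CompactSpace M] (x y : ℕ → M) :
    Summable fun j : ℕ => dist (x j) (y j) / 2 ^ j := by
  refine Summable.of_nonneg_of_le (fun j => by positivity) (fun j => ?_)
    (summable_geometric_two.mul_left (Metric.diam (univ : Set M)))
  rw [div_eq_mul_inv, one_div, inv_pow]
  exact mul_le_mul_of_nonneg_right
    (Metric.dist_le_diam_of_mem isCompact_univ.isBounded (mem_univ _) (mem_univ _)) (by positivity)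

/-- The space of forward suborbits carries the metric `ρ(x, y) = ∑ⱼ dist(xⱼ, yⱼ) / 2ʲ`. -/
instance metricSpaceForwardSuborbits [MetricSpace M] [CompactSpace M]
    (F : SetRel M M) : MetricSpace (ForwardSuborbits F) where
  dist x y := ∑' j : ℕ, dist (x.1 j) (y.1 j) / 2 ^ j
  dist_self x := by simp
  dist_comm x y := by simp [dist_comm]
  dist_triangle x y z := by
    rw [← (summable_rho x.1 y.1).tsum_add (summable_rho y.1 z.1)]
    refine (summable_rho x.1 z.1).tsum_le_tsum (fun j => ?_)
      ((summable_rho x.1 y.1).add (summable_rho y.1 z.1))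
    rw [← add_div]
    exact div_le_div_of_nonneg_right (dist_triangle _ _ _) (by positivity)
  eq_of_dist_eq_zero {x y} h := by
    have h' := (hasSum_zero_iff_of_nonneg (fun j => by positivity)).1
      (h ▸ (summable_rho x.1 y.1).hasSum)
    refine Subtype.ext (funext fun j => ?_)
    have hj := congrFun h' j
    simpa using hj

/-- The one-sided shift `σ_F` on the space of forward suborbits. -/
def shift (F : SetRel M M) (x : ForwardSuborbits F) : ForwardSuborbits F :=
  ⟨fun i => x.1 (i + 1), fun i => x.2 (i + 1)⟩

end SetValued

end

/-!
Positive entropy comes from continua. Let `R` be an iterate of `F` and `D ⊆ M` a continuum. By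
Hausdorff continuity, a relatively clopen part of `R(D)` that meets one of the sets `R(w)`, `w ∈ D`,
meets all of them; as components of a compact set are intersections of clopen sets, *every component
of `R(D)` meets every `R(w)`* (`connectedComponentIn_image_inter_nonempty`), even when the sets
`R(w)` are themselves disconnected.

Suppose now that `D` contains two points `x, y` at distance at least `δ`. Positive expansiveness,
made uniform by compactness (`PositivelyExpansive.exists_uniform_time`), gives a time `n ≤ N(δ)` and
a point of `Fⁿ(x)` at distance at least `β` from `Fⁿ(y)`, up to exchanging `x` and `y`. The
component of that point in `Fⁿ(D)` also meets `Fⁿ(y)`, hence is a continuum of diameter at least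
`β`, where `β` does not depend on `δ`. By boundary bumping (`exists_subcontinuum`) it contains two
continua, of diameter at least `β / 3` and `β / 3` apart (`exists_branching`). With `δ = β / 3` the
construction can be repeated inside each of them, and following a binary tree of such choices for
`k` generations gives `2ᵏ` suborbits which separate pairwise up to time `k N`
(`exists_separated_suborbits`), so the entropy is positive: it is at least `log 2 / (N + 2)`
(`entropyAt_pos_of_two_pow_le_sepNumber`).

The comparison with the shift holds because separated segments extend to forward suborbits that form
a dynamical net of the shift (`entropy_le_coverEntropy_shift`).
-/

namespace SetValued

variable {M : Type*}

/-! ### Continua in compact spaces -/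

/-- In a compact set `K`, a component that avoids a closed set is separated from it by a relatively
clopen subset of `K`. -/
theorem connectedComponentIn_inter_nonempty [TopologicalSpace M] [T2Space M] {K Y : Set M} {z : M}
    (hK : IsCompact K) (hz : z ∈ K) (hY : IsClosed Y)
    (h : ∀ V ⊆ K, IsClosed V → IsClosed (K \ V) → z ∈ V → (V ∩ Y).Nonempty) :
    (connectedComponentIn K z ∩ Y).Nonempty := by
  have : CompactSpace K := isCompact_iff_compactSpace.1 hK
  have hemb : IsClosedEmbedding (Subtype.val : K → M) := hK.isClosed.isClosedEmbedding_subtypeVal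
  rw [connectedComponentIn_eq_image hz, connectedComponent_eq_iInter_isClopen]
  by_contra hne
  rw [not_nonempty_iff_eq_empty] at hne
  have hY' : IsCompact (Subtype.val ⁻¹' Y : Set K) :=
    (hY.preimage continuous_subtype_val).isCompact
  have : Nonempty { s : Set K // IsClopen s ∧ (⟨z, hz⟩ : K) ∈ s } :=
    ⟨univ, isClopen_univ, mem_univ _⟩
  obtain ⟨⟨s, hs, hzs⟩, hsY⟩ := hY'.elim_directed_family_closed
    (fun s : { s : Set K // IsClopen s ∧ (⟨z, hz⟩ : K) ∈ s } => (s : Set K))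
    (fun s => s.2.1.isClosed)
    (by
      rw [eq_empty_iff_forall_notMem] at hne ⊢
      rintro x ⟨hxY, hx⟩
      exact hne x ⟨⟨x, hx, rfl⟩, hxY⟩)
    (fun s t => ⟨⟨s ∩ t, s.2.1.inter t.2.1, s.2.2, t.2.2⟩, inter_subset_left, inter_subset_right⟩)
  obtain ⟨y, ⟨x, hxs, rfl⟩, hyY⟩ := h (Subtype.val '' s) (Subtype.coe_image_subset K s)
    (hemb.isClosedMap s hs.isClosed)
    (by
      have hc : K \ Subtype.val '' s = Subtype.val '' sᶜ := by
        ext x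
        simp
      rw [hc]
      exact hemb.isClosedMap _ hs.compl.isClosed)
    ⟨_, hzs, rfl⟩
  exact (eq_empty_iff_forall_notMem.1 hsY x) ⟨hyY, hxs⟩

theorem isClosed_connectedComponentIn [TopologicalSpace M] {K : Set M} (hK : IsClosed K) (z : M) :
    IsClosed (connectedComponentIn K z) := by
  by_cases hz : z ∈ K
  · rw [connectedComponentIn_eq_image hz]
    exact hK.isClosedEmbedding_subtypeVal.isClosedMap _ isClosed_connectedComponent
  · rw [connectedComponentIn_eq_empty hz]
    exact isClosed_empty

/-- Boundary bumping: inside a ball of radius `r` around `p`, a continuum that leaves the ball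
contains a continuum joining `p` to the boundary sphere. -/
theorem exists_subcontinuum [MetricSpace M] {K : Set M} (hK : IsCompact K)
    (hconn : IsPreconnected K) {p q : M} (hp : p ∈ K) (hq : q ∈ K) {r : ℝ} (hr : 0 ≤ r)
    (hpq : r ≤ dist q p) :
    ∃ C ⊆ K ∩ Metric.closedBall p r, IsClosed C ∧ IsPreconnected C ∧ p ∈ C ∧
      ∃ c ∈ C, r ≤ dist c p := by
  set B := K ∩ Metric.closedBall p r
  have hpB : p ∈ B := ⟨hp, Metric.mem_closedBall_self hr⟩
  have hB : IsCompact B := hK.inter_right Metric.isClosed_closedBall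
  have hY : IsClosed {y : M | r ≤ dist y p} := isClosed_le continuous_const (by fun_prop)
  refine ⟨connectedComponentIn B p, connectedComponentIn_subset _ _,
    isClosed_connectedComponentIn hB.isClosed p, isPreconnected_connectedComponentIn,
    mem_connectedComponentIn hpB, ?_⟩
  refine connectedComponentIn_inter_nonempty hB hpB hY fun V hVB hV hV' hpV => ?_
  -- If `V` missed the sphere, it would be clopen in all of `K`.
  obtain ⟨x, -, hxV, hx | hx⟩ := isPreconnected_closed_iff.1 hconn V ((B \ V) ∪ {y | r ≤ dist y p})
    hV (hV'.union hY)
    (fun x hx => by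
      by_cases hxV : x ∈ V
      · exact Or.inl hxV
      · rcases le_total (dist x p) r with h | h
        · exact Or.inr (Or.inl ⟨⟨hx, h⟩, hxV⟩)
        · exact Or.inr (Or.inr h))
    ⟨p, hp, hpV⟩ ⟨q, hq, Or.inr hpq⟩
  · exact absurd hxV hx.2
  · exact ⟨x, hxV, hx⟩

/-- A continuum with two points `β` apart contains two continua which are `β / 3` apart and both of
which have two points `β / 3` apart. -/
theorem exists_two_subcontinua [MetricSpace M] {K : Set M} (hK : IsCompact K)
    (hconn : IsPreconnected K) {p q : M} (hp : p ∈ K) (hq : q ∈ K) {β : ℝ} (hβ : 0 < β)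
    (hpq : β ≤ dist p q) :
    ∃ C : Bool → Set M, (∀ b, C b ⊆ K ∧ IsClosed (C b) ∧ IsPreconnected (C b) ∧
        ∃ x ∈ C b, ∃ y ∈ C b, β / 3 ≤ dist x y) ∧
      ∀ x ∈ C false, ∀ y ∈ C true, β / 3 ≤ dist x y := by
  obtain ⟨C, hC, hCc, hCp, hpC, c, hc, hcp⟩ := exists_subcontinuum hK hconn hp hq
    (r := β / 3) (by positivity) (by rw [dist_comm]; linarith)
  obtain ⟨D, hD, hDc, hDp, hqD, d, hd, hdq⟩ := exists_subcontinuum hK hconn hq hp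
    (r := β / 3) (by positivity) (by linarith)
  refine ⟨fun b => bif b then D else C, ?_, fun x hx y hy => ?_⟩
  · rintro (_ | _)
    · exact ⟨hC.trans inter_subset_left, hCc, hCp, c, hc, p, hpC, hcp⟩
    · exact ⟨hD.trans inter_subset_left, hDc, hDp, d, hd, q, hqD, hdq⟩
  · have h1 : dist x p ≤ β / 3 := (hC hx).2
    have h2 : dist y q ≤ β / 3 := (hD hy).2
    have h3 := dist_triangle4 p x y q
    rw [dist_comm p x] at h3
    linarith

/-! ### Uniform continuity and closedness of the iterates -/

/-- Uniform continuity of `x ↦ R(x)` for the Hausdorff distance, in `ε`-`δ` form. One of the two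
inclusions between neighbourhoods suffices, since `x` and `y` may be exchanged. -/
def UniformlyHausdorffContinuous [MetricSpace M] (R : SetRel M M) : Prop :=
  ∀ ε > 0, ∃ δ > 0, ∀ x y : M, dist x y < δ → ∀ z ∈ im R x, ∃ w ∈ im R y, dist z w < ε

theorem HausdorffContinuous.uniformlyHausdorffContinuous [MetricSpace M] [CompactSpace M]
    {F : SetRel M M} (hcont : HausdorffContinuous F) (hne : ∀ x, (im F x).Nonempty)
    (hclosed : ∀ x, IsClosed (im F x)) : UniformlyHausdorffContinuous F := by
  let f : M → TopologicalSpace.NonemptyCompacts M :=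
    fun x => ⟨⟨im F x, (hclosed x).isCompact⟩, hne x⟩
  have hf : Continuous f := by
    refine Metric.continuous_iff.2 fun x ε hε => ?_
    obtain ⟨δ, hδ, h⟩ := hcont x ε hε
    refine ⟨δ, hδ, fun y hy => ?_⟩
    rw [dist_comm, Metric.NonemptyCompacts.dist_eq]
    exact h y (by rwa [dist_comm])
  intro ε hε
  obtain ⟨δ, hδ, h⟩ :=
    Metric.uniformContinuous_iff.1 (CompactSpace.uniformContinuous_of_continuous hf) ε hε
  refine ⟨δ, hδ, fun x y hxy z hz => ?_⟩
  have hd := h hxy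
  rw [Metric.NonemptyCompacts.dist_eq] at hd
  exact Metric.exists_dist_lt_of_hausdorffDist_lt hz hd
    (Metric.hausdorffEDist_ne_top_of_nonempty_of_bounded (hne x) (hne y)
      (hclosed x).isCompact.isBounded (hclosed y).isCompact.isBounded)

theorem UniformlyHausdorffContinuous.isClosed [MetricSpace M] {R : SetRel M M}
    (hR : UniformlyHausdorffContinuous R) (hclosed : ∀ x, IsClosed (im R x)) :
    IsClosed (R : Set (M × M)) := by
  refine isClosed_of_closure_subset fun ⟨x, z⟩ hxz => ?_
  refine (hclosed x).closure_subset (Metric.mem_closure_iff.2 fun ε hε => ?_)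
  obtain ⟨δ, hδ, h⟩ := hR (ε / 2) (half_pos hε)
  obtain ⟨⟨x', z'⟩, hmem, hd⟩ := Metric.mem_closure_iff.1 hxz (min δ (ε / 2))
    (lt_min hδ (half_pos hε))
  rw [Prod.dist_eq, max_lt_iff, lt_min_iff, lt_min_iff] at hd
  obtain ⟨w, hw, hzw⟩ := h x' x (by rw [dist_comm]; exact hd.1.1) z' hmem
  refine ⟨w, hw, ?_⟩
  have h1 := dist_triangle z z' w
  have h2 : dist z z' < ε / 2 := hd.2.2
  linarith

theorem UniformlyHausdorffContinuous.iter [MetricSpace M] {F : SetRel M M}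
    (hF : UniformlyHausdorffContinuous F) (n : ℕ) : UniformlyHausdorffContinuous (iter F n) := by
  induction n with
  | zero =>
    refine fun ε hε => ⟨ε, hε, fun x y hxy z hz => ⟨y, rfl, ?_⟩⟩
    obtain rfl : x = z := hz
    exact hxy
  | succ n ih =>
    intro ε hε
    obtain ⟨η, hη, h⟩ := hF ε hε
    obtain ⟨δ, hδ, h'⟩ := ih η hη
    refine ⟨δ, hδ, fun x y hxy z hz => ?_⟩
    obtain ⟨m, hm, hmz⟩ := hz
    obtain ⟨m', hm', hd⟩ := h' x y hxy m hm
    obtain ⟨w, hw, hzw⟩ := h m m' hd z hmz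
    exact ⟨w, ⟨m', hm', hw⟩, hzw⟩

theorem isClosed_relComp [TopologicalSpace M] [CompactSpace M] {R S : SetRel M M}
    (hR : IsClosed (R : Set (M × M))) (hS : IsClosed (S : Set (M × M))) :
    IsClosed (R.comp S : Set (M × M)) := by
  have heq : (R.comp S : Set (M × M)) = (fun p : (M × M) × M => p.1) ''
      {p : (M × M) × M | (p.1.1, p.2) ∈ R ∧ (p.2, p.1.2) ∈ S} := by
    ext ⟨x, z⟩
    constructor
    · rintro ⟨y, h1, h2⟩
      exact ⟨((x, z), y), ⟨h1, h2⟩, rfl⟩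
    · rintro ⟨⟨⟨x', z'⟩, y⟩, ⟨h1, h2⟩, h3⟩
      obtain ⟨rfl, rfl⟩ := Prod.ext_iff.1 h3
      exact ⟨y, h1, h2⟩
  rw [heq]
  refine isClosedMap_fst_of_compactSpace _ (IsClosed.inter ?_ ?_)
  · exact hR.preimage (f := fun p : (M × M) × M => (p.1.1, p.2)) (by fun_prop)
  · exact hS.preimage (f := fun p : (M × M) × M => (p.2, p.1.2)) (by fun_prop)

theorem isClosed_iter [MetricSpace M] [CompactSpace M] {F : SetRel M M}
    (hF : IsClosed (F : Set (M × M))) (n : ℕ) : IsClosed (iter F n : Set (M × M)) := by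
  induction n with
  | zero => exact isClosed_diagonal
  | succ n ih => exact isClosed_relComp ih hF

theorem isClosed_image [TopologicalSpace M] [CompactSpace M] {R : SetRel M M}
    (hR : IsClosed (R : Set (M × M))) {D : Set M} (hD : IsClosed D) : IsClosed (R.image D) := by
  have heq : R.image D = Prod.snd '' ((R : Set (M × M)) ∩ Prod.fst ⁻¹' D) := by
    ext y
    constructor
    · rintro ⟨x, hx, hxy⟩
      exact ⟨(x, y), ⟨hxy, hx⟩, rfl⟩
    · rintro ⟨⟨x, y⟩, ⟨hxy, hx⟩, rfl⟩
      exact ⟨x, hx, hxy⟩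
  rw [heq]
  exact isClosedMap_snd_of_compactSpace _ (hR.inter (hD.preimage continuous_fst))

/-! ### Growth of continua -/

/-- Every component of the image of a continuum meets the image of each of its points. -/
theorem connectedComponentIn_image_inter_nonempty [MetricSpace M] [CompactSpace M] {R : SetRel M M}
    (hR : IsClosed (R : Set (M × M))) (hcont : UniformlyHausdorffContinuous R) {D : Set M}
    (hD : IsClosed D) (hconn : IsPreconnected D) {x y z : M} (hx : x ∈ D) (hy : y ∈ D)
    (hz : z ∈ im R x) : (connectedComponentIn (R.image D) z ∩ im R y).Nonempty := by
  refine connectedComponentIn_inter_nonempty (isClosed_image hR hD).isCompact ⟨x, hx, hz⟩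
    (hR.preimage (f := fun w => (y, w)) (by fun_prop)) fun V hV hVc hVc' hzV => ?_
  -- The two clopen parts of the image are a positive distance apart.
  obtain ⟨ε, hε, hsep⟩ := Metric.exists_pos_forall_lt_edist hVc.isCompact hVc' disjoint_sdiff_right
  obtain ⟨δ, hδ, h⟩ := hcont ε (by exact_mod_cast hε)
  have hstep : ∀ w ∈ D, ∀ w' ∈ D, dist w w' < δ →
      (V ∩ im R w).Nonempty → (V ∩ im R w').Nonempty := by
    rintro w - w' hw' hd ⟨v, hvV, hv⟩
    obtain ⟨v', hv', hvv'⟩ := h w w' hd v hv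
    refine ⟨v', by_contra fun hv'V => ?_, hv'⟩
    have hlt := hsep v hvV v' ⟨⟨w', hw', hv'⟩, hv'V⟩
    rw [edist_nndist, ENNReal.coe_lt_coe, ← NNReal.coe_lt_coe, coe_nndist] at hlt
    exact lt_asymm hlt hvv'
  refine hconn.induction₂' (fun w w' => (V ∩ im R w).Nonempty → (V ∩ im R w').Nonempty)
    (fun w hw => ?_) (fun _ _ _ _ _ _ h1 h2 => h2 ∘ h1) hx hy ⟨z, hzV, hz⟩
  filter_upwards [self_mem_nhdsWithin, mem_nhdsWithin_of_mem_nhds (Metric.ball_mem_nhds w hδ)]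
    with w' hw' hd
  exact ⟨hstep w hw w' hw' (by rwa [dist_comm]), hstep w' hw' w hw hd⟩

/-- `x` and `y` are told apart at time `n`: some point of `Fⁿ(x)` is at distance at least `β` from
all of `Fⁿ(y)`. -/
def FarAt [MetricSpace M] (F : SetRel M M) (β : ℝ) (n : ℕ) (x y : M) : Prop :=
  ∃ z ∈ im (iter F n) x, ∀ w ∈ im (iter F n) y, β ≤ dist z w

theorem exists_farAt_of_lt_hausdorffDist [MetricSpace M] {F : SetRel M M} {α : ℝ} (hα : 0 ≤ α)
    {n : ℕ} {x y : M} (h : α < Metric.hausdorffDist (im (iter F n) x) (im (iter F n) y)) :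
    FarAt F α n x y ∨ FarAt F α n y x := by
  by_contra! hcon
  obtain ⟨h1, h2⟩ := hcon
  unfold FarAt at h1 h2
  push Not at h1 h2
  refine h.not_ge (Metric.hausdorffDist_le_of_mem_dist hα (fun z hz => ?_) (fun z hz => ?_))
  · obtain ⟨w, hw, hd⟩ := h1 z hz
    exact ⟨w, hw, hd.le⟩
  · obtain ⟨w, hw, hd⟩ := h2 z hz
    exact ⟨w, hw, hd.le⟩

theorem FarAt.of_dist_lt [MetricSpace M] {F : SetRel M M} {β δ ε : ℝ} {n : ℕ} {x y x' y' : M}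
    (h : FarAt F β n x y) (hδ : ∀ x y : M, dist x y < δ →
      ∀ z ∈ im (iter F n) x, ∃ w ∈ im (iter F n) y, dist z w < ε)
    (hx : dist x x' < δ) (hy : dist y y' < δ) : FarAt F (β - 2 * ε) n x' y' := by
  obtain ⟨z, hz, hzw⟩ := h
  obtain ⟨z', hz', hd⟩ := hδ x x' hx z hz
  refine ⟨z', hz', fun w' hw' => ?_⟩
  obtain ⟨w, hw, hd'⟩ := hδ y' y (by rwa [dist_comm]) w' hw'
  have h1 := hzw w hw
  have h2 := dist_triangle4 z z' w' w
  linarith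

/-- By compactness, the time at which expansiveness tells two points apart is bounded in terms of
their distance, at the price of halving the expansiveness constant. -/
theorem PositivelyExpansive.exists_uniform_time [MetricSpace M] [CompactSpace M] {F : SetRel M M}
    (hcont : UniformlyHausdorffContinuous F) (hexp : PositivelyExpansive F) :
    ∃ β > 0, ∀ δ > 0, ∃ N : ℕ, ∀ x y : M, δ ≤ dist x y →
      ∃ n ≤ N, FarAt F β n x y ∨ FarAt F β n y x := by
  obtain ⟨α, hα, hexp⟩ := hexp
  refine ⟨α / 2, half_pos hα, fun δ hδ => ?_⟩
  have hS : IsCompact {p : M × M | δ ≤ dist p.1 p.2} :=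
    (isClosed_le continuous_const (by fun_prop)).isCompact
  suffices ∃ N : ℕ, ∀ p ∈ {p : M × M | δ ≤ dist p.1 p.2},
      ∃ n ≤ N, FarAt F (α / 2) n p.1 p.2 ∨ FarAt F (α / 2) n p.2 p.1 from
    this.imp fun N h x y hxy => h (x, y) hxy
  refine hS.induction_on (p := fun S : Set (M × M) => ∃ N : ℕ, ∀ p ∈ S,
      ∃ n ≤ N, FarAt F (α / 2) n p.1 p.2 ∨ FarAt F (α / 2) n p.2 p.1) ⟨0, by simp⟩
    (fun S T hST ⟨N, hN⟩ => ⟨N, fun p hp => hN p (hST hp)⟩) ?_ ?_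
  · rintro S T ⟨N, hN⟩ ⟨N', hN'⟩
    refine ⟨max N N', ?_⟩
    rintro p (hp | hp)
    · obtain ⟨n, hn, h⟩ := hN p hp
      exact ⟨n, le_max_of_le_left hn, h⟩
    · obtain ⟨n, hn, h⟩ := hN' p hp
      exact ⟨n, le_max_of_le_right hn, h⟩
  · rintro ⟨x, y⟩ hxy
    have hne : x ≠ y := dist_pos.1 (hδ.trans_le hxy)
    obtain ⟨n, hn⟩ := hexp x y hne
    obtain ⟨η, hη, h⟩ := hcont.iter n (α / 4) (by positivity)
    refine ⟨Metric.ball (x, y) η, mem_nhdsWithin_of_mem_nhds (Metric.ball_mem_nhds _ hη), n, ?_⟩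
    rintro ⟨x', y'⟩ hd
    rw [Metric.mem_ball', Prod.dist_eq, max_lt_iff] at hd
    refine ⟨n, le_rfl, ?_⟩
    have hc : α / 2 = α - 2 * (α / 4) := by ring
    rw [hc]
    exact (exists_farAt_of_lt_hausdorffDist hα.le hn).imp
      (fun hf => hf.of_dist_lt h hd.1 hd.2) (fun hf => hf.of_dist_lt h hd.2 hd.1)

/-- A continuum of diameter at least `δ`. -/
def IsLargeContinuum [MetricSpace M] (δ : ℝ) (D : Set M) : Prop :=
  IsClosed D ∧ IsPreconnected D ∧ ∃ x ∈ D, ∃ y ∈ D, δ ≤ dist x y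

/-- Within bounded time, large continua contain two large continua in their image that are
a definite distance apart. -/
theorem exists_branching [MetricSpace M] [CompactSpace M] {F : SetRel M M}
    (hF : IsClosed (F : Set (M × M))) (hcont : UniformlyHausdorffContinuous F) {β : ℝ} (hβ : 0 < β)
    {N : ℕ} (hN : ∀ x y : M, β / 3 ≤ dist x y → ∃ n ≤ N, FarAt F β n x y ∨ FarAt F β n y x)
    {D : Set M} (hD : IsLargeContinuum (β / 3) D) :
    ∃ n ≤ N, ∃ C : Bool → Set M,
      (∀ b, C b ⊆ (iter F n).image D ∧ IsLargeContinuum (β / 3) (C b)) ∧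
      ∀ x ∈ C false, ∀ y ∈ C true, β / 3 ≤ dist x y := by
  obtain ⟨hDc, hDp, x₀, hx₀, y₀, hy₀, hd⟩ := hD
  obtain ⟨n, hn, hfar⟩ := hN x₀ y₀ hd
  obtain ⟨x, hx, y, hy, z, hz, hzw⟩ : ∃ x ∈ D, ∃ y ∈ D, FarAt F β n x y :=
    hfar.elim (fun h => ⟨x₀, hx₀, y₀, hy₀, h⟩) (fun h => ⟨y₀, hy₀, x₀, hx₀, h⟩)
  obtain ⟨w, hwE, hw⟩ := connectedComponentIn_image_inter_nonempty (isClosed_iter hF n)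
    (hcont.iter n) hDc hDp hx hy hz
  have hE := isClosed_connectedComponentIn (isClosed_image (isClosed_iter hF n) hDc) z
  obtain ⟨C, hC, hCsep⟩ := exists_two_subcontinua hE.isCompact isPreconnected_connectedComponentIn
    (mem_connectedComponentIn (⟨x, hx, hz⟩ : z ∈ (iter F n).image D)) hwE hβ (hzw w hw)
  exact ⟨n, hn, C, fun b => ⟨(hC b).1.trans (connectedComponentIn_subset _ _), (hC b).2⟩, hCsep⟩

/-! ### Trees of suborbits -/

theorem exists_forward_suborbit {F : SetRel M M} (h : ∀ x, ∃ y, (x, y) ∈ F) (x : M) :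
    ∃ u : ℕ → M, u 0 = x ∧ ∀ i, (u i, u (i + 1)) ∈ F := by
  choose g hg using h
  exact ⟨fun n => g^[n] x, rfl, fun i => by
    simp only [Function.iterate_succ_apply']
    exact hg _⟩

theorem exists_forward_suborbit_extend {F : SetRel M M} {n : ℕ} {x : M} {v : ℕ → M}
    (hx : (x, v 0) ∈ iter F n) (hv : ∀ i, (v i, v (i + 1)) ∈ F) :
    ∃ u : ℕ → M, u 0 = x ∧ (∀ i, (u i, u (i + 1)) ∈ F) ∧ ∀ i, u (n + i) = v i := by
  induction n generalizing v with
  | zero =>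
    obtain rfl : x = v 0 := hx
    exact ⟨v, rfl, hv, fun i => by rw [Nat.zero_add]⟩
  | succ n ih =>
    obtain ⟨m, hm, hmv⟩ := hx
    obtain ⟨u, hu0, hu, huv⟩ := ih (v := fun i => Nat.casesOn i m v) hm (by
      rintro (_ | i)
      · exact hmv
      · exact hv i)
    exact ⟨u, hu0, hu, fun i => by rw [Nat.add_assoc, Nat.add_comm 1 i, huv (i + 1)]⟩

theorem exists_suborbit_extend {F : SetRel M M} (h : ∀ y, ∃ x, (x, y) ∈ F) {u : ℕ → M}
    (hu : ∀ i, (u i, u (i + 1)) ∈ F) : ∃ x ∈ suborbits F, ∀ i : ℕ, x i = u i := by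
  choose g hg using h
  refine ⟨fun i => Int.casesOn i u fun n => g^[n + 1] (u 0), ?_, fun _ => rfl⟩
  rintro (n | _ | n)
  · exact hu n
  · exact hg (u 0)
  · change (g^[n + 2] (u 0), g^[n + 1] (u 0)) ∈ F
    rw [Function.iterate_succ_apply' g (n + 1)]
    exact hg _

/-- If the members of a family of sets branch, within time `N`, into two members of the family that
are `ε` apart, then each of them is the origin of `2ᵏ` suborbits that separate up to time
`k N`: two branches separate when they first differ. The branching time may depend on the set. -/
theorem exists_separated_suborbits [MetricSpace M] {F : SetRel M M} {P : Set M → Prop} {ε : ℝ}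
    {N : ℕ} (hF : ∀ x, ∃ y, (x, y) ∈ F) (hne : ∀ D, P D → D.Nonempty)
    (hP : ∀ D, P D → ∃ n ≤ N, ∃ C : Bool → Set M,
      (∀ b, C b ⊆ (iter F n).image D ∧ P (C b)) ∧ ∀ x ∈ C false, ∀ y ∈ C true, ε ≤ dist x y)
    (k : ℕ) (D : Set M) (hD : P D) :
    ∃ u : (Fin k → Bool) → ℕ → M, (∀ b, u b 0 ∈ D ∧ ∀ i, (u b i, u b (i + 1)) ∈ F) ∧
      ∀ b c, b ≠ c → ∃ t ≤ k * N, ε ≤ dist (u b t) (u c t) := by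
  induction k generalizing D with
  | zero =>
    obtain ⟨x, hx⟩ := hne D hD
    obtain ⟨u, hu0, hu⟩ := exists_forward_suborbit hF x
    exact ⟨fun _ => u, fun _ => ⟨mem_of_eq_of_mem hu0 hx, hu⟩,
      fun b c hbc => (hbc (Subsingleton.elim b c)).elim⟩
  | succ k ih =>
    obtain ⟨n, hn, C, hC, hsep⟩ := hP D hD
    choose v hv hvsep using fun b => ih (C b) (hC b).2
    choose x hxD hx using fun b c => (hC b).1 (hv b c).1
    choose u hu0 hu huv using fun b c => exists_forward_suborbit_extend (hx b c) (hv b c).2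
    refine ⟨fun b => u (b 0) (Fin.tail b), fun b => ⟨?_, hu _ _⟩, fun b c hbc => ?_⟩
    · exact mem_of_eq_of_mem (hu0 _ _) (hxD _ _)
    · have hle : n + k * N ≤ (k + 1) * N := by
        rw [Nat.succ_mul]
        omega
      by_cases h0 : b 0 = c 0
      · have ht : Fin.tail b ≠ Fin.tail c := fun ht => hbc (by
          rw [← Fin.cons_self_tail b, ← Fin.cons_self_tail c, h0, ht])
        obtain ⟨t, ht, hd⟩ := hvsep (b 0) _ _ ht
        refine ⟨n + t, by omega, ?_⟩
        simp only [← h0, huv]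
        exact hd
      · refine ⟨n, by omega, ?_⟩
        have hu' : ∀ b c, u b c n ∈ C b := fun b c => by
          have := huv b c 0
          rw [Nat.add_zero] at this
          exact this ▸ (hv b c).1
        have key : ∀ a a' : Bool, a ≠ a' → ∀ y ∈ C a, ∀ y' ∈ C a', ε ≤ dist y y' := by
          rintro (_ | _) (_ | _) ha y hy y' hy'
          · exact absurd rfl ha
          · exact hsep y hy y' hy'
          · exact dist_comm y y' ▸ hsep y' hy' y hy
          · exact absurd rfl ha
        exact key _ _ h0 _ (hu' _ _) _ (hu' _ _)

/-! ### Entropy -/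

theorem card_le_sepNumber [MetricSpace M] {F : SetRel M M} (h : ∀ y, ∃ x, (x, y) ∈ F) {ι : Type*}
    [Fintype ι] {u : ι → ℕ → M} (hu : ∀ b i, (u b i, u b (i + 1)) ∈ F) {n : ℕ} {ε : ℝ} (hε : 0 ≤ ε)
    (hsep : ∀ b c, b ≠ c → ∃ t < n, ε < dist (u b t) (u c t)) :
    (Fintype.card ι : ℕ∞) ≤ sepNumber F n ε := by
  classical
  have hinj : Function.Injective fun (b : ι) (i : Fin n) => u b i := by
    intro b c hbc
    by_contra hne
    obtain ⟨t, ht, hd⟩ := hsep b c hne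
    have hut : u b t = u c t := congrFun hbc ⟨t, ht⟩
    rw [hut, dist_self] at hd
    exact hd.not_ge hε
  rw [← Finset.card_univ, ← Finset.card_image_of_injective _ hinj]
  refine le_iSup₂_of_le (Finset.univ.image fun (b : ι) (i : Fin n) => u b i) ⟨?_, ?_⟩ le_rfl
  · intro s hs
    obtain ⟨b, -, rfl⟩ := Finset.mem_image.1 (Finset.mem_coe.1 hs)
    obtain ⟨x, hx, hxu⟩ := exists_suborbit_extend h (hu b)
    exact ⟨x, hx, fun i => (hxu i).symm⟩
  · intro s hs s' hs' hne
    obtain ⟨b, -, rfl⟩ := Finset.mem_image.1 (Finset.mem_coe.1 hs)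
    obtain ⟨c, -, rfl⟩ := Finset.mem_image.1 (Finset.mem_coe.1 hs')
    obtain ⟨t, ht, hd⟩ := hsep b c fun hbc => hne (by rw [hbc])
    exact ⟨⟨t, ht⟩, hd⟩

theorem entropyAt_pos_of_two_pow_le_sepNumber [MetricSpace M] {F : SetRel M M} {ε : ℝ} {N : ℕ}
    (h : ∀ k : ℕ, ((2 ^ k : ℕ) : ℕ∞) ≤ sepNumber F (k * (N + 1) + 1) ε) : 0 < entropyAt F ε := by
  have hlog : (0 : EReal) < ENNReal.log 2 := by
    rw [← ENNReal.log_one]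
    exact ENNReal.log_strictMono (by norm_num)
  -- The rate along the times `k (N + 1) + 1`, `k ≥ 1`, is at least `k log 2 / (k (N + 2))`.
  have hN : (0 : EReal) < ((N + 2 : ℕ) : EReal) := by exact_mod_cast Nat.succ_pos _
  have hN' : ((N + 2 : ℕ) : EReal) ≠ ⊤ := EReal.natCast_ne_top _
  refine (EReal.div_pos hlog hN hN').trans_le (le_limsup_of_frequently_le ?_)
  refine frequently_atTop.2 fun a => ⟨(a + 1) * (N + 1) + 1, by nlinarith, ?_⟩
  have hpos : (0 : EReal) < (((a + 1) * (N + 1) + 1 : ℕ) : EReal) := by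
    exact_mod_cast Nat.succ_pos _
  rw [EReal.le_div_iff_mul_le hpos (EReal.natCast_ne_top _)]
  have hnum : ((a + 1 : ℕ) : EReal) * ENNReal.log 2 ≤
      ENNReal.log (sepNumber F ((a + 1) * (N + 1) + 1) ε : ENNReal) := by
    rw [← ENNReal.log_pow]
    refine ENNReal.log_monotone ?_
    have := ENat.toENNReal_mono (h (a + 1))
    simpa using this
  refine le_trans ?_ hnum
  have hcast : (((a + 1) * (N + 1) + 1 : ℕ) : EReal) ≤
      ((N + 2 : ℕ) : EReal) * ((a + 1 : ℕ) : EReal) := by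
    rw [← EReal.natCast_mul]
    exact_mod_cast (by nlinarith : (a + 1) * (N + 1) + 1 ≤ (N + 2) * (a + 1))
  calc ENNReal.log 2 / ((N + 2 : ℕ) : EReal) * (((a + 1) * (N + 1) + 1 : ℕ) : EReal)
      ≤ ENNReal.log 2 / ((N + 2 : ℕ) : EReal) * (((N + 2 : ℕ) : EReal) * ((a + 1 : ℕ) : EReal)) :=
        mul_le_mul_of_nonneg_left hcast (EReal.div_nonneg hlog.le hN.le)
    _ = ((a + 1 : ℕ) : EReal) * ENNReal.log 2 := by
        rw [← mul_assoc, EReal.div_mul_cancel (EReal.natCast_ne_bot _) hN' hN.ne', mul_comm]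

theorem entropy_pos [MetricSpace M] [CompactSpace M] [ConnectedSpace M] [Nontrivial M]
    {F : SetRel M M} (hsurj : IsSurjective F) (hclosed : ∀ x : M, IsClosed (im F x))
    (hcont : HausdorffContinuous F) (hexp : PositivelyExpansive F) : 0 < entropy F := by
  have hcont' := hcont.uniformlyHausdorffContinuous hsurj.1 hclosed
  have hF := hcont'.isClosed hclosed
  obtain ⟨β, hβ, hunif⟩ := hexp.exists_uniform_time hcont'
  obtain ⟨N, hN⟩ := hunif (β / 3) (by positivity)
  -- The root of the tree is `M`, which is large as it has two points that can be told apart.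
  have hM : IsLargeContinuum (β / 3) (univ : Set M) := by
    refine ⟨isClosed_univ, isPreconnected_univ, ?_⟩
    obtain ⟨a, b, hab⟩ := exists_pair_ne M
    obtain ⟨N', hN'⟩ := hunif (dist a b) (dist_pos.2 hab)
    have hne : ∀ n (x : M), ∃ w, w ∈ im (iter F n) x := by
      intro n x
      induction n with
      | zero => exact ⟨x, rfl⟩
      | succ n ih =>
        obtain ⟨w, hw⟩ := ih
        obtain ⟨w', hw'⟩ := hsurj.1 w
        exact ⟨w', w, hw, hw'⟩
    obtain ⟨n, -, ⟨z, -, hz⟩ | ⟨z, -, hz⟩⟩ := hN' a b le_rfl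
    · obtain ⟨w, hw⟩ := hne n b
      exact ⟨z, mem_univ _, w, mem_univ _, by linarith [hz w hw]⟩
    · obtain ⟨w, hw⟩ := hne n a
      exact ⟨z, mem_univ _, w, mem_univ _, by linarith [hz w hw]⟩
  have hpos : 0 < entropyAt F (β / 6) := by
    refine entropyAt_pos_of_two_pow_le_sepNumber (N := N) fun k => ?_
    obtain ⟨u, hu, hsep⟩ := exists_separated_suborbits hsurj.1
      (fun D (hD : IsLargeContinuum (β / 3) D) => hD.2.2.imp fun _ h => h.1)
      (fun D hD => exists_branching hF hcont' hβ hN hD) k univ hM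
    have := card_le_sepNumber (n := k * (N + 1) + 1) (ε := β / 6) hsurj.2 (fun b => (hu b).2)
      (by positivity) (fun b c hbc => by
        obtain ⟨t, ht, hd⟩ := hsep b c hbc
        exact ⟨t, by nlinarith, by linarith⟩)
    simpa using this
  exact hpos.trans_le (le_iSup₂_of_le (β / 6) (by positivity) le_rfl)

/-! ### Comparison with the shift -/

theorem shift_iterate_apply (F : SetRel M M) (k : ℕ) (x : ForwardSuborbits F) (i : ℕ) :
    ((shift F)^[k] x).1 i = x.1 (i + k) := by
  induction k generalizing x with
  | zero => rfl
  | succ k ih =>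
    rw [Function.iterate_succ_apply, ih]
    exact congrArg x.1 (by omega)

theorem dist_zero_le_dist [MetricSpace M] [CompactSpace M] {F : SetRel M M}
    (x y : ForwardSuborbits F) : dist (x.1 0) (y.1 0) ≤ dist x y := by
  have h := (summable_rho x.1 y.1).le_tsum 0 fun j _ => by positivity
  simpa using! h

theorem sepNumber_le_netMaxcard_shift [MetricSpace M] [CompactSpace M] (F : SetRel M M) (n : ℕ)
    (ε : ℝ) : sepNumber F n ε ≤ Dynamics.netMaxcard (shift F) univ
      {p : ForwardSuborbits F × ForwardSuborbits F | dist p.1 p.2 < ε / 2} n := by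
  classical
  refine iSup₂_le fun A hA => ?_
  have hext : ∀ s : A, ∃ x : ForwardSuborbits F, ∀ i : Fin n, x.1 i = s.1 i := by
    rintro ⟨s, hs⟩
    obtain ⟨x, hx, hxs⟩ := hA.1 (Finset.mem_coe.2 hs)
    exact ⟨⟨fun i => x i, fun i => by exact_mod_cast hx i⟩, fun i => (hxs i).symm⟩
  choose e he using hext
  have hinj : Function.Injective e := fun s t hst =>
    Subtype.ext (funext fun i => by rw [← he s i, ← he t i, hst])
  rw [← Fintype.card_coe, ← Finset.card_univ, ← Finset.card_image_of_injective _ hinj]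
  refine Dynamics.IsDynNetIn.card_le_netMaxcard ⟨subset_univ _, ?_⟩
  intro x hx y hy hxy
  obtain ⟨s, -, rfl⟩ := Finset.mem_image.1 (Finset.mem_coe.1 hx)
  obtain ⟨t, -, rfl⟩ := Finset.mem_image.1 (Finset.mem_coe.1 hy)
  obtain ⟨i, hi⟩ := hA.2 s.1 s.2 t.1 t.2 fun h => hxy (congrArg e (Subtype.ext h))
  refine disjoint_left.2 fun z hzs hzt => ?_
  have h1 : dist ((shift F)^[i] (e s)) ((shift F)^[i] z) < ε / 2 :=
    Dynamics.mem_ball_dynEntourage.1 hzs i i.2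
  have h2 : dist ((shift F)^[i] (e t)) ((shift F)^[i] z) < ε / 2 :=
    Dynamics.mem_ball_dynEntourage.1 hzt i i.2
  have h3 := dist_zero_le_dist ((shift F)^[i] (e s)) ((shift F)^[i] (e t))
  rw [shift_iterate_apply, shift_iterate_apply, Nat.zero_add, he, he] at h3
  have h4 := dist_triangle_right ((shift F)^[i] (e s)) ((shift F)^[i] (e t)) ((shift F)^[i] z)
  linarith

theorem entropy_le_coverEntropy_shift [MetricSpace M] [CompactSpace M] (F : SetRel M M) :
    entropy F ≤ Dynamics.coverEntropy (shift F) univ := by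
  refine iSup₂_le fun ε hε => ?_
  refine le_trans ?_ (Dynamics.netEntropyEntourage_le_coverEntropy (T := shift F) (F := univ)
    (Metric.dist_mem_uniformity (half_pos hε)))
  refine limsup_le_limsup (Eventually.of_forall fun n => ?_)
  refine EReal.div_le_div_right_of_nonneg (by exact_mod_cast Nat.zero_le n) ?_
  exact ENNReal.log_monotone (ENat.toENNReal_mono (sepNumber_le_netMaxcard_shift F n ε))

end SetValued

theorem mainTheorem4 {M : Type*} [MetricSpace M] [CompactSpace M] [ConnectedSpace M]
    [LocallyConnectedSpace M] [Nontrivial M] (F : SetRel M M)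
    (hsurj : SetValued.IsSurjective F)
    (hclosed : ∀ x : M, IsClosed (SetValued.im F x))
    (hcont : SetValued.HausdorffContinuous F)
    (hexp : SetValued.PositivelyExpansive F)
    (hcond : (∀ x : M, IsConnected (SetValued.im F x)) ∨
      IsClosed (SetValued.iterateFamily F)) :
    SetValued.entropy F ≤ Dynamics.coverEntropy (SetValued.shift F) Set.univ ∧
      0 < SetValued.entropy F :=
  ⟨SetValued.entropy_le_coverEntropy_shift F, SetValued.entropy_pos hsurj hclosed hcont hexp⟩
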